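/- Conventions: $\widehat f(\xi)=\int_{\mathbb R^3}e^{-ix\cdot\xi}f(x)\,dx$, $f(x)=(2\pi)^{-3}\int_{\mathbb R^3}e^{ix\cdot\xi}\widehat f(\xi)\,d\xi$, so that $|\nabla|$ is the Fourier multiplier with symbol $|\xi|$. Every $f\in L^{4/3}(\mathbb R^3)$ has a distributional Fourier transform $\widehat f$, and $\widehat f\in L^4(\mathbb R^3)$. Let $(\psi_j)_{j\ge 0}$ be smooth real-valued functions on $(0,\infty)$, extended by $0$ to $\mathbb R$, such that $\psi_j$ is supported in $[2^{-j-1},2^{-j+1}]$, $\sum_{j\ge0}\psi_j(r)=1$ for $0<r\le1$, and $|\psi_j|\le M$ for all $j$ with some constant $M$ (for instance, $0\le\psi_j\le1$). For an energy gap $\Delta E>0$ and $0<\varepsilon<1$ define, for $f\in L^{4/3}(\mathbb R^3)$, $$\widehat{\mathcal T_{\varepsilon,j}f}(\xi)=\frac{\psi_j\bigl(\bigl||\xi|-\Delta E\bigr|\bigr)}{\bigl||\xi|-\Delta E\bigr|+\varepsilon}\,\widehat f(\xi),\qquad \mathcal T_\varepsilon=\sum_{j=0}^{J}\mathcal T_{\varepsilon,j},\qquad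 J=\lfloor\log_2(1/\varepsilon)\rfloor ,$$ that is, $\mathcal T_\varepsilon$ is the regularized multiplier $\bigl(\bigl||\nabla|-\Delta E\bigr|+\varepsilon\bigr)^{-1}$ localized dyadically near the resonance sphere $\{|\xi|=\Delta E\}$. Lemma (Tomas–Stein bound for the regularized multiplier). For every $\Delta E>0$, $M$ and $\varepsilon_0<1$ there is a constant $C>0$, independent of $\varepsilon$, $J$ and $f$ (and depending on $(\psi_j)$ only through $M$), such that for all $0<\varepsilon\le\varepsilon_0$ and all $f\in L^{4/3}(\mathbb R^3)$ one has $\mathcal T_\varepsilon f\in L^4(\mathbb R^3)$ and $$\|\mathcal T_\varepsilon f\|_{L^4(\mathbb R^3)}\le C\log\!\Bigl(\frac1\varepsilon\Bigr)\|f\|_{L^{4/3}(\mathbb R^3)} .$$ -/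

import Mathlib

open MeasureTheory
open scoped ENNReal ContDiff FourierTransform SchwartzMap

noncomputable section

/-- Three-dimensional Euclidean space. -/
abbrev R3 : Type := EuclideanSpace ℝ (Fin 3)

instance fact_one_le_four_thirds : Fact ((1 : ℝ≥0∞) ≤ 4 / 3) :=
  ⟨by rw [ENNReal.le_div_iff_mul_le (by simp) (by simp)]; norm_num⟩

instance fact_one_le_four : Fact ((1 : ℝ≥0∞) ≤ 4) := ⟨by norm_num⟩

/-- A smooth dyadic partition of unity on `(0, 1]`: each `ψ j` is smooth and supported in
`[2^(-j-1), 2^(-j+1)]`, and the `ψ j` sum to `1` on `(0, 1]`. -/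
structure IsDyadicPartition (ψ : ℕ → ℝ → ℝ) : Prop where
  contDiff : ∀ j, ContDiff ℝ ∞ (ψ j)
  tsupport_subset : ∀ j : ℕ,
    tsupport (ψ j) ⊆ Set.Icc ((2 : ℝ) ^ (-(j : ℤ) - 1)) ((2 : ℝ) ^ (-(j : ℤ) + 1))
  hasSum_one : ∀ r : ℝ, 0 < r → r ≤ 1 → HasSum (fun j => ψ j r) 1

/-- `g ∈ L⁴` is the Fourier transform of `f ∈ L^{4/3}` in the sense of tempered distributions. -/
def IsFourierTransform (f : Lp ℂ (4 / 3) (volume : Measure R3))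
    (g : Lp ℂ 4 (volume : Measure R3)) : Prop :=
  𝓕 (f : 𝓢'(R3, ℂ)) = (g : 𝓢'(R3, ℂ))

/-- There is at most one such `g`. -/
theorem IsFourierTransform.unique {f : Lp ℂ (4 / 3) (volume : Measure R3)}
    {g₁ g₂ : Lp ℂ 4 (volume : Measure R3)}
    (h₁ : IsFourierTransform f g₁) (h₂ : IsFourierTransform f g₂) : g₁ = g₂ := by
  have h : (g₁ : 𝓢'(R3, ℂ)) = (g₂ : 𝓢'(R3, ℂ)) := h₁.symm.trans h₂
  have hinj := LinearMap.ker_eq_bot.1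
    (Lp.ker_toTemperedDistributionCLM_eq_bot (F := ℂ) (p := 4) (μ := (volume : Measure R3)))
  exact hinj h

open Classical in
/-- The Fourier transform `L^{4/3}(ℝ³) → L⁴(ℝ³)`, normalized as in Mathlib (kernel
`exp (-2πi⟨x, ξ⟩)`). The value `0` is used only if `f` has no Fourier transform in `L⁴`
(which does not occur, by the Hausdorff–Young inequality). -/
def fourierFourThirds (f : Lp ℂ (4 / 3) (volume : Measure R3)) : Lp ℂ 4 (volume : Measure R3) :=
  if h : ∃ g, IsFourierTransform f g then h.choose else 0

/-- The radial symbol `ψ_j(|r - ΔE|) / (|r - ΔE| + ε)` of the `j`-th shell operator. -/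
def shellSymbol (ψ : ℕ → ℝ → ℝ) (ΔE ε : ℝ) (j : ℕ) (r : ℝ) : ℝ :=
  ψ j |r - ΔE| / (|r - ΔE| + ε)

/-- The `j`-th shell operator: the Fourier multiplier with symbol `shellSymbol ψ ΔE ε j` applied
to `|∇|`. With Mathlib's normalization of the Fourier transform, `|∇|` is multiplication by
`2π‖ξ‖` on the frequency side. The symbol is bounded with compact support and the Fourier
transform is in `L⁴`, so the inverse Fourier integral converges absolutely. -/
def shellOp (ψ : ℕ → ℝ → ℝ) (ΔE ε : ℝ) (j : ℕ) (f : Lp ℂ (4 / 3) (volume : Measure R3)) :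
    R3 → ℂ :=
  𝓕⁻ (fun ξ : R3 => (shellSymbol ψ ΔE ε j (2 * Real.pi * ‖ξ‖) : ℂ) * fourierFourThirds f ξ)

/-- The number `J = ⌊log₂ (1/ε)⌋` of the last shell. -/
def lastShell (ε : ℝ) : ℕ := ⌊Real.logb 2 (1 / ε)⌋₊

/-- The regularized multiplier `T_ε = ∑_{j=0}^{J} T_{ε,j}`, localized dyadically near the
resonance sphere `|ξ| = ΔE`. -/
def regularizedMultiplier (ψ : ℕ → ℝ → ℝ) (ΔE ε : ℝ) (f : Lp ℂ (4 / 3) (volume : Measure R3)) :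
    R3 → ℂ :=
  fun x => ∑ j ∈ Finset.range (lastShell ε + 1), shellOp ψ ΔE ε j f x

end

/-! The exponent 4 is the Tomas–Stein endpoint for the sphere in three dimensions, and a shell of
thickness `d` around it has an `L^{4/3} → L⁴` multiplier norm of order `d` times the supremum of the
symbol. The `j`-th symbol has size at most of order `2^j` and lives on a shell of thickness about
`2^{-j}`, so each shell operator is bounded uniformly in `j` and `ε` (`shellOp_bound`). The
logarithm is the number of shells.

Because 4 is even, no oscillatory integrals or decay of the surface measure are needed. Since `(𝓕
g)² = 𝓕 (g ⋆ g)`, Plancherel reduces the extension estimate for `g` supported in `S` to an `L²`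
bound on `g ⋆ g`, and Cauchy–Schwarz reduces that to the measure of `S ∩ (x - S)`. This measure is
`O(d²)` uniformly in `x` once the shell is cut into octants (`volume_shellPiece_inter_le`); for the
whole shell, `x = 0` would only give `O(d)`. Duality gives the restriction estimate on Schwartz
functions, density extends it to `L^{4/3}`, and composing restriction with extension gives the
multiplier bound. -/

open Filter Topology

/-! ### Plancherel, Young and Hausdorff–Young. -/

/-- On `L¹ ∩ L²` the Fourier integral agrees with the `L²` Fourier transform. -/
theorem fourier_ae_eq_fourier_toLp {f : R3 → ℂ} (h1 : Integrable f) (h2 : MemLp f 2) :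
    𝓕 f =ᵐ[volume] (𝓕 (h2.toLp f) : Lp ℂ 2 (volume : Measure R3)) := by
  have hc : Continuous (𝓕 f) :=
    VectorFourier.fourierIntegral_continuous Real.continuous_fourierChar
      (by exact continuous_inner) h1
  refine ae_eq_of_integral_contDiff_smul_eq hc.locallyIntegrable
    ((Lp.memLp _).locallyIntegrable (by norm_num)) fun g hg hgs => ?_
  let G : R3 → ℂ := fun x => (g x : ℂ)
  have hGs : HasCompactSupport G := hgs.comp_left (g := ((↑) : ℝ → ℂ)) (by simp)
  have hG : ContDiff ℝ ∞ G := Complex.ofRealCLM.contDiff.comp hg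
  let s : 𝓢(R3, ℂ) := hGs.toSchwartzMap hG
  have hs : ∀ x, s x = g x := fun x => rfl
  -- Both sides are compared as distributions: the transform moves onto the test function, where the
  -- integrable representative can be used.
  have key := congrArg (fun T => T s) (Lp.fourier_toTemperedDistribution_eq (h2.toLp f))
  simp only [TemperedDistribution.fourier_apply, Lp.toTemperedDistribution_apply] at key
  have e1 : ∫ x, (𝓕 s) x • (h2.toLp f) x = ∫ x, (𝓕 s) x • f x :=
    integral_congr_ae (by filter_upwards [h2.coeFn_toLp] with x hx; rw [hx])
  have e2 : ∫ x, (𝓕 s) x • f x = ∫ x, s x • 𝓕 f x := by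
    have := VectorFourier.integral_fourierIntegral_smul_eq_flip (μ := volume) (ν := volume)
      (L := innerₗ R3) Real.continuous_fourierChar continuous_inner s.integrable h1
    rw [SchwartzMap.fourier_coe]
    rw [flip_innerₗ] at this
    exact this
  rw [e1, e2] at key
  simpa [hs] using key

/-- Plancherel's identity for the Fourier integral on `L¹ ∩ L²`. -/
theorem eLpNorm_fourier_two {f : R3 → ℂ} (h1 : Integrable f) (h2 : MemLp f 2) :
    eLpNorm (𝓕 f) 2 volume = eLpNorm f 2 volume := by
  rw [eLpNorm_congr_ae (fourier_ae_eq_fourier_toLp h1 h2), ← Lp.enorm_def, ← eLpNorm_congr_ae h2.coeFn_toLp,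
    ← Lp.enorm_def, ← ofReal_norm, ← ofReal_norm, Lp.norm_fourier_eq]

theorem eLpNorm_pow_eq_lintegral {α : Type*} [MeasurableSpace α] {μ : Measure α} (f : α → ℂ)
    {n : ℕ} (hn : n ≠ 0) : eLpNorm f n μ ^ n = ∫⁻ x, ‖f x‖ₑ ^ n ∂μ := by
  have := eLpNorm_nnreal_pow_eq_lintegral (f := f) (μ := μ) (p := (n : NNReal)) (by exact_mod_cast hn)
  simpa using this

-- The square of `𝓕 f` is the transform of `f ⋆ f`, so Plancherel turns an `L⁴` norm into the `L²`
-- norm of a self-convolution. Hausdorff–Young and the extension estimate both start from this.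
open scoped Convolution in
theorem lintegral_fourier_pow_four_le {f : R3 → ℂ} (h1 : Integrable f) :
    ∫⁻ ξ, ‖𝓕 f ξ‖ₑ ^ 4 ≤ ∫⁻ x, (∫⁻ y, ‖f y‖ₑ * ‖f (x - y)‖ₑ) ^ 2 := by
  set F : R3 → ℂ := f ⋆[ContinuousLinearMap.mul ℂ ℂ] f with hF
  have hF1 : Integrable F := h1.integrable_convolution _ h1
  have hle : ∀ x, ‖F x‖ₑ ≤ ∫⁻ y, ‖f y‖ₑ * ‖f (x - y)‖ₑ := fun x => by
    refine (enorm_integral_le_lintegral_enorm _).trans (le_of_eq ?_)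
    simp [enorm_mul]
  have hle2 : ∫⁻ x, ‖F x‖ₑ ^ 2 ≤ ∫⁻ x, (∫⁻ y, ‖f y‖ₑ * ‖f (x - y)‖ₑ) ^ 2 :=
    lintegral_mono fun x => by gcongr; exact hle x
  -- Plancherel needs `F ∈ L²`, which holds unless the right side is infinite and there is nothing
  -- to prove.
  by_cases htop : ∫⁻ x, (∫⁻ y, ‖f y‖ₑ * ‖f (x - y)‖ₑ) ^ 2 = ⊤
  · rw [htop]; exact le_top
  have hF2 : MemLp F 2 := by
    refine ⟨hF1.aestronglyMeasurable, ?_⟩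
    have h := eLpNorm_pow_eq_lintegral (μ := volume) F (n := 2) two_ne_zero
    have h' : eLpNorm F 2 volume ^ 2 < ⊤ := by
      rw [Nat.cast_ofNat] at h
      rw [h]; exact hle2.trans_lt (lt_top_iff_ne_top.2 htop)
    by_contra hcon
    rw [not_lt_top_iff.1 hcon] at h'
    simp at h'
  refine le_trans (le_of_eq ?_) hle2
  have a := eLpNorm_pow_eq_lintegral (μ := volume) F (n := 2) two_ne_zero
  have b := eLpNorm_pow_eq_lintegral (μ := volume) (𝓕 F) (n := 2) two_ne_zero
  rw [Nat.cast_ofNat] at a b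
  rw [← a, ← eLpNorm_fourier_two hF1 hF2, b]
  congr 1; ext ξ
  rw [Real.fourier_mul_convolution_eq h1 h1, enorm_mul]; ring

theorem lintegral_mul_sq_le {α : Type*} [MeasurableSpace α] {μ : Measure α} {f g : α → ℝ≥0∞}
    (hf : AEMeasurable f μ) (hg : AEMeasurable g μ) :
    (∫⁻ x, f x * g x ∂μ) ^ 2 ≤ (∫⁻ x, f x ^ 2 ∂μ) * ∫⁻ x, g x ^ 2 ∂μ := by
  have h := ENNReal.lintegral_mul_le_Lp_mul_Lq μ Real.HolderConjugate.two_two hf hg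
  calc _ ≤ _ := pow_le_pow_left' h 2
    _ = _ := by
      rw [mul_pow, ← ENNReal.rpow_natCast, ← ENNReal.rpow_natCast, ← ENNReal.rpow_mul,
        ← ENNReal.rpow_mul]
      norm_num

/-- The integral of the convolution of two functions, in the form of a double integral. -/
theorem lintegral_lintegral_mul_sub {φ ψ : R3 → ℝ≥0∞} (hφ : Measurable φ) (hψ : Measurable ψ) :
    ∫⁻ x, ∫⁻ y, φ y * ψ (x - y) = (∫⁻ x, φ x) * ∫⁻ x, ψ x := by
  rw [lintegral_lintegral_swap (by fun_prop)]
  have : ∀ y, ∫⁻ x, φ y * ψ (x - y) = φ y * ∫⁻ x, ψ x := fun y => by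
    rw [lintegral_const_mul _ (by fun_prop), lintegral_sub_right_eq_self ψ y]
  simp_rw [this]
  exact lintegral_mul_const _ hφ

/-- Young's convolution inequality `L^{4/3} * L^{4/3} ⊆ L²`. -/
theorem lintegral_young {φ : R3 → ℝ≥0∞} (hφ : Measurable φ) :
    ∫⁻ x, (∫⁻ y, φ y * φ (x - y)) ^ 2 ≤ (∫⁻ x, φ x ^ (4 / 3 : ℝ)) ^ 3 := by
  set A := ∫⁻ x, φ x ^ (4 / 3 : ℝ)
  -- Two rounds of Cauchy–Schwarz: the powers `2/3` square to the integrable exponent `4/3`, and the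
  -- remaining powers `1/3` are handled by a second application.
  have hsplit : ∀ t : ℝ≥0∞, t = t ^ (2 / 3 : ℝ) * t ^ (1 / 3 : ℝ) := fun t => by
    rw [← ENNReal.rpow_add_of_nonneg _ _ (by norm_num) (by norm_num)]; norm_num
  have hsq : ∀ (t : ℝ≥0∞) (a : ℝ), (t ^ a) ^ 2 = t ^ (2 * a) := fun t a => by
    rw [← ENNReal.rpow_natCast, ← ENNReal.rpow_mul, mul_comm]; norm_num
  have hrefl : ∀ x, ∫⁻ y, φ (x - y) ^ (4 / 3 : ℝ) = A := fun x =>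
    lintegral_sub_left_eq_self (fun y => φ y ^ (4 / 3 : ℝ)) x
  have h2 : ∀ x, ∫⁻ y, (φ y ^ (1 / 3 : ℝ) * φ (x - y) ^ (1 / 3 : ℝ)) ^ 2 ≤ A := fun x => by
    have h := lintegral_mul_sq_le (μ := volume) (f := fun y => φ y ^ (2 / 3 : ℝ))
      (g := fun y => φ (x - y) ^ (2 / 3 : ℝ)) (by fun_prop) (by fun_prop)
    simp only [hsq] at h
    norm_num at h
    rw [hrefl, ← sq] at h
    have h' := (ENNReal.pow_le_pow_left_iff two_ne_zero).1 h
    simp only [mul_pow, hsq]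
    norm_num
    exact h'
  have h1 : ∀ x, (∫⁻ y, φ y * φ (x - y)) ^ 2 ≤
      (∫⁻ y, φ y ^ (4 / 3 : ℝ) * φ (x - y) ^ (4 / 3 : ℝ)) * A := fun x => by
    have h := lintegral_mul_sq_le (μ := volume)
      (f := fun y => φ y ^ (2 / 3 : ℝ) * φ (x - y) ^ (2 / 3 : ℝ))
      (g := fun y => φ y ^ (1 / 3 : ℝ) * φ (x - y) ^ (1 / 3 : ℝ)) (by fun_prop) (by fun_prop)
    have e : ∀ y, φ y ^ (2 / 3 : ℝ) * φ (x - y) ^ (2 / 3 : ℝ) *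
        (φ y ^ (1 / 3 : ℝ) * φ (x - y) ^ (1 / 3 : ℝ)) = φ y * φ (x - y) := fun y => by
      conv_rhs => rw [hsplit (φ y), hsplit (φ (x - y))]
      ring
    simp only [e] at h
    refine h.trans ?_
    gcongr
    · simp only [mul_pow, hsq]; norm_num
    · exact h2 x
  calc _ ≤ ∫⁻ x, (∫⁻ y, φ y ^ (4 / 3 : ℝ) * φ (x - y) ^ (4 / 3 : ℝ)) * A :=
        lintegral_mono h1
    _ = _ := by
      rw [lintegral_mul_const _ (by fun_prop), lintegral_lintegral_mul_sub
        (φ := fun x => φ x ^ (4 / 3 : ℝ)) (ψ := fun x => φ x ^ (4 / 3 : ℝ)) (by fun_prop)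
        (by fun_prop)]
      ring

theorem eLpNorm_four_thirds_pow (f : R3 → ℂ) :
    eLpNorm f (4 / 3) volume ^ 4 = (∫⁻ x, ‖f x‖ₑ ^ (4 / 3 : ℝ)) ^ 3 := by
  have h : (4 / 3 : ℝ≥0∞).toReal = 4 / 3 := by simp
  rw [eLpNorm_eq_lintegral_rpow_enorm_toReal (by simp) (by finiteness), h,
    ← ENNReal.rpow_natCast, ← ENNReal.rpow_mul, ← ENNReal.rpow_natCast]
  norm_num

/-- The Hausdorff–Young inequality `L^{4/3} → L⁴` for integrable functions. -/
theorem eLpNorm_fourier_four_le {f : R3 → ℂ} (h1 : Integrable f) (hf : Measurable f) :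
    eLpNorm (𝓕 f) 4 volume ≤ eLpNorm f (4 / 3) volume := by
  refine (ENNReal.pow_le_pow_left_iff (n := 4) (by norm_num)).1 ?_
  have a := eLpNorm_pow_eq_lintegral (μ := volume) (𝓕 f) (n := 4) (by norm_num)
  rw [Nat.cast_ofNat] at a
  rw [a, eLpNorm_four_thirds_pow]
  exact (lintegral_fourier_pow_four_le h1).trans (lintegral_young (by fun_prop))

/-! ### The bilinear extension estimate. -/

/-- Extension estimate for functions supported in a set `S` all of whose
intersections `S ∩ (x - S)` have measure at most `K`. -/
theorem lintegral_fourier_pow_four_le_of_support {S : Set R3} {K : ℝ≥0∞}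
    (hS : MeasurableSet S) (hK : ∀ x, volume {y | y ∈ S ∧ x - y ∈ S} ≤ K)
    {g : R3 → ℂ} (h1 : Integrable g) (hg : Measurable g) (hgS : ∀ y ∉ S, g y = 0) :
    ∫⁻ ξ, ‖𝓕 g ξ‖ₑ ^ 4 ≤ K * (∫⁻ ξ, ‖g ξ‖ₑ ^ 2) ^ 2 := by
  refine (lintegral_fourier_pow_four_le h1).trans ?_
  have hpt : ∀ x, (∫⁻ y, ‖g y‖ₑ * ‖g (x - y)‖ₑ) ^ 2 ≤
      K * ∫⁻ y, ‖g y‖ₑ ^ 2 * ‖g (x - y)‖ₑ ^ 2 := fun x => by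
    set B : Set R3 := {y | y ∈ S ∧ x - y ∈ S}
    have hB : MeasurableSet B := hS.inter ((measurable_const.sub measurable_id) hS)
    -- The integrand vanishes off `B`, so Cauchy–Schwarz against the indicator costs only the
    -- measure of `B`.
    have h := lintegral_mul_sq_le (μ := volume) (f := B.indicator 1)
      (g := fun y => ‖g y‖ₑ * ‖g (x - y)‖ₑ) ((measurable_one.indicator hB).aemeasurable)
      (by fun_prop)
    have e1 : ∀ y, B.indicator (1 : R3 → ℝ≥0∞) y * (‖g y‖ₑ * ‖g (x - y)‖ₑ) =
        ‖g y‖ₑ * ‖g (x - y)‖ₑ := fun y => by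
      by_cases hy : y ∈ B
      · simp [hy]
      · have : g y = 0 ∨ g (x - y) = 0 := by
          by_contra! hcon
          exact hy ⟨by_contra fun h' => hcon.1 (hgS _ h'), by_contra fun h' => hcon.2 (hgS _ h')⟩
        rcases this with h' | h' <;> simp [h']
    have e2 : ∫⁻ y, B.indicator (1 : R3 → ℝ≥0∞) y ^ 2 = volume B := by
      rw [← lintegral_indicator_one hB]
      congr 1; ext y
      by_cases hy : y ∈ B <;> simp [hy]
    simp only [e1, e2, mul_pow] at h
    refine h.trans ?_
    gcongr
    exact hK x
  calc _ ≤ ∫⁻ x, K * ∫⁻ y, ‖g y‖ₑ ^ 2 * ‖g (x - y)‖ₑ ^ 2 := lintegral_mono hpt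
    _ = _ := by
      rw [lintegral_const_mul _ (by fun_prop), lintegral_lintegral_mul_sub
        (φ := fun x => ‖g x‖ₑ ^ 2) (ψ := fun x => ‖g x‖ₑ ^ 2) (by fun_prop) (by fun_prop), sq]

/-! ### Geometry of thin shells. -/

/-- The area of a disc is linear in its squared radius, so the bound does not depend on `c`. Planar
slices of a thin shell therefore have uniformly small area, even near the poles. -/
theorem volume_annulus_le (c L : ℝ) (hL : 0 ≤ L) :
    volume {p : Fin 2 → ℝ | c ≤ p 0 ^ 2 + p 1 ^ 2 ∧ p 0 ^ 2 + p 1 ^ 2 ≤ c + L} ≤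
      ENNReal.ofReal (Real.pi * L) := by
  have hmp := (EuclideanSpace.volume_preserving_symm_measurableEquiv_toLp (Fin 2))
  rw [← hmp.measure_preimage_equiv]
  have hsub : ((MeasurableEquiv.toLp 2 (Fin 2 → ℝ)).symm ⁻¹'
      {p : Fin 2 → ℝ | c ≤ p 0 ^ 2 + p 1 ^ 2 ∧ p 0 ^ 2 + p 1 ^ 2 ≤ c + L}) =
      {p : EuclideanSpace ℝ (Fin 2) | c ≤ ‖p‖ ^ 2 ∧ ‖p‖ ^ 2 ≤ c + L} := by
    ext p
    simp [EuclideanSpace.norm_sq_eq, Fin.sum_univ_two]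
  rw [hsub]
  rcases lt_or_ge (c + L) 0 with hneg | hpos
  · have : {p : EuclideanSpace ℝ (Fin 2) | c ≤ ‖p‖ ^ 2 ∧ ‖p‖ ^ 2 ≤ c + L} = ∅ := by
      ext p; simp only [Set.mem_ofPred_eq, Set.mem_empty_iff_false, iff_false]
      rintro ⟨-, h⟩; nlinarith [sq_nonneg ‖p‖]
    rw [this]; simp
  rcases le_or_gt c 0 with hc | hc
  · calc _ ≤ volume (Metric.closedBall (0 : EuclideanSpace ℝ (Fin 2)) (√(c + L))) := by
          refine measure_mono fun p hp => ?_
          rw [mem_closedBall_zero_iff]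
          exact Real.le_sqrt_of_sq_le hp.2
      _ ≤ _ := by
        rw [EuclideanSpace.volume_closedBall_fin_two, ← ENNReal.ofReal_pow (by positivity),
          Real.sq_sqrt hpos, ← ENNReal.ofReal_mul hpos]
        refine ENNReal.ofReal_le_ofReal ?_
        nlinarith [Real.pi_pos]
  · calc _ ≤ volume (Metric.closedBall (0 : EuclideanSpace ℝ (Fin 2)) (√(c + L)) \
          Metric.ball (0 : EuclideanSpace ℝ (Fin 2)) (√c)) := by
          refine measure_mono fun p hp => ⟨?_, ?_⟩
          · rw [mem_closedBall_zero_iff]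
            exact Real.le_sqrt_of_sq_le hp.2
          · rw [mem_ball_zero_iff, not_lt]
            exact Real.sqrt_le_iff.2 ⟨norm_nonneg _, hp.1⟩
      _ ≤ _ := by
        rw [measure_sdiff ((Metric.ball_subset_ball (Real.sqrt_le_sqrt (by linarith))).trans
          Metric.ball_subset_closedBall) measurableSet_ball.nullMeasurableSet
          measure_ball_lt_top.ne, EuclideanSpace.volume_closedBall_fin_two,
          EuclideanSpace.volume_ball_fin_two, ← ENNReal.ofReal_pow (by positivity),
          ← ENNReal.ofReal_pow (by positivity),
          Real.sq_sqrt hpos, Real.sq_sqrt hc.le,  ← ENNReal.ofReal_mul hpos, ← ENNReal.ofReal_mul hc.le,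
          ← ENNReal.ofReal_sub _ (by positivity)]
        refine ENNReal.ofReal_le_ofReal (le_of_eq ?_)
        ring

/-- The part of a thin spherical annulus between two parallel planes has small volume. -/
theorem volume_slab_annulus_le (u : R3) (hu : ‖u‖ = 1) (a w q L : ℝ) (hL : 0 ≤ L) :
    volume {y : R3 | |inner ℝ u y - a| ≤ w ∧ q ≤ ‖y‖ ^ 2 ∧ ‖y‖ ^ 2 ≤ q + L} ≤
      ENNReal.ofReal (2 * w) * ENNReal.ofReal (Real.pi * L) := by
  obtain ⟨b, hb⟩ : ∃ b : OrthonormalBasis (Fin 3) ℝ R3, b 0 = u := by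
    have h : Orthonormal ℝ (Set.domRestrict {(0 : Fin 3)} (fun _ : Fin 3 => u)) := by
      refine ⟨fun _ => hu, fun i j hij => ?_⟩
      exact absurd (Subsingleton.elim i j) hij
    obtain ⟨b, hb⟩ := h.exists_orthonormalBasis_extension_of_card_eq (by simp)
    exact ⟨b, hb 0 rfl⟩
  -- The slab set in orthonormal coordinates with first axis `u`; Fubini then slices it by planes
  -- orthogonal to `u`.
  set T : Set (ℝ × (Fin 2 → ℝ)) := {z | |z.1 - a| ≤ w ∧ q ≤ z.1 ^ 2 + (z.2 0 ^ 2 + z.2 1 ^ 2) ∧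
    z.1 ^ 2 + (z.2 0 ^ 2 + z.2 1 ^ 2) ≤ q + L} with hT
  have hTm : MeasurableSet T := by
    measurability
  have hmp := ((volume_preserving_piFinSuccAbove (fun _ : Fin 3 => ℝ) 0).comp
    (EuclideanSpace.volume_preserving_symm_measurableEquiv_toLp (Fin 3))).comp
    b.measurePreserving_repr
  have hpre : {y : R3 | |inner ℝ u y - a| ≤ w ∧ q ≤ ‖y‖ ^ 2 ∧ ‖y‖ ^ 2 ≤ q + L} =
      (((MeasurableEquiv.piFinSuccAbove (fun _ : Fin 3 => ℝ) 0) ∘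
        (MeasurableEquiv.toLp 2 (Fin 3 → ℝ)).symm) ∘ b.repr) ⁻¹' T := by
    ext y
    have hn : ‖y‖ ^ 2 = (b.repr y 0) ^ 2 + ((b.repr y 1) ^ 2 + (b.repr y 2) ^ 2) := by
      rw [← b.repr.norm_map y, EuclideanSpace.norm_sq_eq, Fin.sum_univ_three]
      simp only [Real.norm_eq_abs, sq_abs]; ring
    simp only [hT, Set.mem_ofPred_eq, Set.mem_preimage, Function.comp, hn, ← hb,
      ← b.repr_apply_apply]
    rfl
  rw [hpre, hmp.measure_preimage hTm.nullMeasurableSet, Measure.volume_eq_prod,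
    Measure.prod_apply hTm]
  calc _ ≤ ∫⁻ t, (Set.Icc (a - w) (a + w)).indicator
        (fun _ => ENNReal.ofReal (Real.pi * L)) t := by
        refine lintegral_mono fun t => ?_
        by_cases ht : t ∈ Set.Icc (a - w) (a + w)
        · rw [Set.indicator_of_mem ht]
          refine le_trans (measure_mono ?_) (volume_annulus_le (q - t ^ 2) L hL)
          rintro p ⟨-, h1, h2⟩
          simp only at h1 h2
          exact ⟨by linarith, by linarith⟩
        · have : Prod.mk t ⁻¹' T = ∅ := by
            ext p
            simp only [Set.mem_preimage, Set.mem_empty_iff_false, iff_false]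
            rintro ⟨h, -⟩
            rw [abs_le] at h
            exact ht ⟨by linarith [h.1], by linarith [h.2]⟩
          rw [this]; simp
    _ = _ := by
      rw [lintegral_indicator measurableSet_Icc, setLIntegral_const, Real.volume_Icc, mul_comm]
      congr 2; ring

/-- The sign pattern of a vector, which names the octant it lies in. -/
noncomputable def octant (ξ : R3) : Fin 3 → Bool := fun i => decide (0 ≤ ξ i)

/-- Coordinates of equal sign have nonnegative products. This rules out cancellation in a sum of two
points of the same shell piece. -/
theorem inner_nonneg_of_octant_eq {ξ η : R3} (h : octant ξ = octant η) : 0 ≤ inner ℝ ξ η := by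
  rw [PiLp.inner_apply]
  refine Finset.sum_nonneg fun i _ => ?_
  have hi := congrFun h i
  simp only [octant, decide_eq_decide] at hi
  simp only [RCLike.inner_apply, conj_trivial]
  by_cases h0 : 0 ≤ ξ i
  · exact mul_nonneg (hi.1 h0) h0
  · exact (mul_pos_of_neg_of_neg (not_le.1 fun h' => h0 (hi.2 h')) (not_le.1 h0)).le

theorem measurable_octant : Measurable octant := by
  refine measurable_pi_iff.2 fun i => ?_
  have : MeasurableSet {ξ : R3 | 0 ≤ ξ i} :=
    (isClosed_le continuous_const (by fun_prop)).measurableSet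
  exact measurable_to_bool (by convert this using 1; ext ξ; simp [octant])

/-- The part of the shell `|‖ξ‖ - r| ≤ d` in the octant `b`. -/
def shellPiece (r d : ℝ) (b : Fin 3 → Bool) : Set R3 := {ξ | |‖ξ‖ - r| ≤ d ∧ octant ξ = b}

theorem measurableSet_shellPiece (r d : ℝ) (b : Fin 3 → Bool) :
    MeasurableSet (shellPiece r d b) :=
  MeasurableSet.inter (s₁ := {ξ : R3 | |‖ξ‖ - r| ≤ d}) (s₂ := octant ⁻¹' {b})
    (isClosed_le (by fun_prop) continuous_const).measurableSet
    (measurable_octant (measurableSet_singleton b))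

theorem shellPiece_subset_closedBall (r d : ℝ) (b : Fin 3 → Bool) :
    shellPiece r d b ⊆ Metric.closedBall 0 (r + d) := fun ξ hξ => by
  rw [mem_closedBall_zero_iff]; linarith [(abs_le.1 hξ.1).2]

/-- Two shell pieces `S` and `x - S` meet in a set of measure `O(d²)`. -/
theorem volume_shellPiece_inter_le {r d : ℝ} (hr : 0 < r) (hd : 0 < d) (hd1 : d ≤ 1)
    (b : Fin 3 → Bool) (x : R3) :
    volume {y | y ∈ shellPiece r d b ∧ x - y ∈ shellPiece r d b} ≤
      ENNReal.ofReal ((36 + 32 * r) * Real.pi * d ^ 2) := by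
  have hpi := Real.pi_pos
  -- For a thick shell the enclosing ball suffices: `(3d)³ ≤ 27d²` gives the constant `36 = 27 ·
  -- 4/3`. The term `32r` is `8d · 4rd` from the slab bound, divided by `d²`.
  rcases le_or_gt r (2 * d) with h | h
  · calc _ ≤ volume (Metric.closedBall (0 : R3) (r + d)) :=
          measure_mono fun y hy => shellPiece_subset_closedBall r d b hy.1
      _ ≤ _ := by
        rw [EuclideanSpace.volume_closedBall_fin_three,
          ← ENNReal.ofReal_pow (by positivity), ← ENNReal.ofReal_mul (by positivity)]
        refine ENNReal.ofReal_le_ofReal ?_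
        have h3 : (r + d) ^ 3 ≤ 27 * d ^ 2 := by
          calc (r + d) ^ 3 ≤ (3 * d) ^ 3 := by gcongr; linarith
            _ = 27 * d ^ 2 * d := by ring
            _ ≤ 27 * d ^ 2 * 1 := by gcongr
            _ = _ := by ring
        have h4 : (r + d) ^ 3 * (Real.pi * 4 / 3) ≤ 27 * d ^ 2 * (Real.pi * 4 / 3) := by gcongr
        have h5 : 0 ≤ r * Real.pi * d ^ 2 := by positivity
        nlinarith
  · rcases Set.eq_empty_or_nonempty {y | y ∈ shellPiece r d b ∧ x - y ∈ shellPiece r d b}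
      with he | ⟨y₀, hy₀, hy₁⟩
    · rw [he]; simp
    -- `x` is the sum of `y₀` and `x - y₀`, which share an octant, so `‖x‖ ≥ ‖y₀‖`.
    have hx : r / 2 ≤ ‖x‖ := by
      have hin := inner_nonneg_of_octant_eq (hy₀.2.trans hy₁.2.symm)
      have e : ‖x‖ ^ 2 = ‖y₀‖ ^ 2 + 2 * inner ℝ y₀ (x - y₀) + ‖x - y₀‖ ^ 2 := by
        rw [← norm_add_sq_real]; simp
      have h1 := (abs_le.1 hy₀.1).1
      have h2 : (r / 2) ^ 2 ≤ ‖y₀‖ ^ 2 := by gcongr; linarith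
      exact le_of_sq_le_sq (by nlinarith [sq_nonneg ‖x - y₀‖]) (norm_nonneg x)
    have hx0 : 0 < ‖x‖ := by linarith
    set u : R3 := (‖x‖)⁻¹ • x with hu
    have hun : ‖u‖ = 1 := by rw [hu, norm_smul, norm_inv, norm_norm, inv_mul_cancel₀ hx0.ne']
    -- Both `‖y‖²` and `‖x - y‖²` lie in an interval of length `4rd`, and their difference
    -- determines `⟨x, y⟩`: it is within `2rd` of `‖x‖²/2`. Dividing by `‖x‖ ≥ r/2` gives the
    -- half-width `4d`.
    refine (measure_mono ?_).trans ((volume_slab_annulus_le u hun (‖x‖ / 2) (4 * d) ((r - d) ^ 2)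
      (4 * r * d) (by positivity)).trans ?_)
    · rintro y ⟨hy, hy'⟩
      obtain ⟨a1, a2⟩ := abs_le.1 hy.1
      obtain ⟨b1, b2⟩ := abs_le.1 hy'.1
      have l1 : (r - d) ^ 2 ≤ ‖y‖ ^ 2 := by gcongr; linarith; linarith
      have l2 : ‖y‖ ^ 2 ≤ (r + d) ^ 2 := by gcongr; linarith
      have m1 : (r - d) ^ 2 ≤ ‖x - y‖ ^ 2 := by gcongr; linarith; linarith
      have m2 : ‖x - y‖ ^ 2 ≤ (r + d) ^ 2 := by gcongr; linarith
      refine ⟨?_, l1, by nlinarith⟩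
      have e := norm_sub_sq_real x y
      have e2 : inner ℝ u y * ‖x‖ = inner ℝ x y := by
        rw [hu, real_inner_smul_left]; field_simp
      have hk : |inner ℝ u y - ‖x‖ / 2| * ‖x‖ ≤ 4 * d * ‖x‖ := by
        calc _ = |(inner ℝ u y - ‖x‖ / 2) * ‖x‖| := by rw [abs_mul, abs_norm]
          _ ≤ 2 * r * d := by
            rw [sub_mul, e2, abs_le]
            constructor <;> nlinarith
          _ ≤ _ := by nlinarith
      exact le_of_mul_le_mul_right hk hx0
    · rw [← ENNReal.ofReal_mul (by positivity)]
      refine ENNReal.ofReal_le_ofReal ?_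
      have : 0 ≤ Real.pi * d ^ 2 := by positivity
      nlinarith

/-! ### The Fourier transform on `L^{4/3}`. -/

theorem enorm_toLp_fourier_le (s : 𝓢(R3, ℂ)) :
    ‖(𝓕 s).toLp 4‖ₑ ≤ ‖s.toLp (4 / 3)‖ₑ := by
  rw [Lp.enorm_def, Lp.enorm_def, eLpNorm_congr_ae (SchwartzMap.coeFn_toLp _ _ _),
    eLpNorm_congr_ae (SchwartzMap.coeFn_toLp _ _ _), SchwartzMap.fourier_coe]
  exact eLpNorm_fourier_four_le s.integrable s.continuous.measurable

/-- Hausdorff–Young makes the transforms of a Schwartz approximation Cauchy in `L⁴`; continuity of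
the distributional transform identifies the limit. The sequence is kept because the restriction
estimate is extended along it. -/
theorem exists_schwartz_tendsto_isFourierTransform (f : Lp ℂ (4 / 3) (volume : Measure R3)) :
    ∃ (s : ℕ → 𝓢(R3, ℂ)) (g : Lp ℂ 4 (volume : Measure R3)),
      Tendsto (fun n => (s n).toLp (4 / 3)) atTop (𝓝 f) ∧
      Tendsto (fun n => (𝓕 (s n)).toLp 4) atTop (𝓝 g) ∧ IsFourierTransform f g := by
  have hdense := SchwartzMap.denseRange_toLpCLM (E := R3) (F := ℂ) (p := 4 / 3)
    (μ := volume) (by finiteness)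
  obtain ⟨u, hu, hlim⟩ := mem_closure_iff_seq_limit.1 (hdense f)
  choose s hs using hu
  have hs' : ∀ n, (s n).toLp (4 / 3) = u n := hs
  have hlim' : Tendsto (fun n => (s n).toLp (4 / 3) (volume : Measure R3)) atTop (𝓝 f) := by
    simpa only [hs'] using hlim
  have hcau : CauchySeq (fun n => (𝓕 (s n)).toLp 4 (volume : Measure R3)) := by
    have hc := hlim'.cauchySeq
    rw [EMetric.cauchySeq_iff] at hc ⊢
    intro ε hε
    obtain ⟨N, hN⟩ := hc ε hε
    refine ⟨N, fun m hm n hn => lt_of_le_of_lt ?_ (hN m hm n hn)⟩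
    have h := enorm_toLp_fourier_le (s m - s n)
    simp only [edist_eq_enorm_sub]
    have e1 : (𝓕 (s m - s n)).toLp 4 (volume : Measure R3) =
        (𝓕 (s m)).toLp 4 (volume : Measure R3) - (𝓕 (s n)).toLp 4 (volume : Measure R3) :=
      map_sub ((SchwartzMap.toLpCLM ℂ ℂ 4 (volume : Measure R3)).comp
        (FourierTransform.fourierCLM ℂ 𝓢(R3, ℂ))) _ _
    have e2 : (s m - s n).toLp (4 / 3) (volume : Measure R3) =
        (s m).toLp (4 / 3) (volume : Measure R3) - (s n).toLp (4 / 3) (volume : Measure R3) :=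
      map_sub (SchwartzMap.toLpCLM ℂ ℂ (4 / 3) (volume : Measure R3)) _ _
    rwa [e1, e2] at h
  obtain ⟨g, hg⟩ := cauchySeq_tendsto_of_complete hcau
  refine ⟨s, g, hlim', hg, ?_⟩
  have t1 : Tendsto (fun n => 𝓕 ((s n).toLp (4 / 3) (volume : Measure R3) : 𝓢'(R3, ℂ))) atTop
      (𝓝 (𝓕 (f : 𝓢'(R3, ℂ)))) :=
    ((FourierTransform.continuous_fourier (E := 𝓢'(R3, ℂ))).comp
      (Lp.toTemperedDistributionCLM ℂ (volume : Measure R3)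
        (4 / 3)).continuous).continuousAt.tendsto.comp hlim'
  have t2 : Tendsto (fun n => ((𝓕 (s n)).toLp 4 (volume : Measure R3) : 𝓢'(R3, ℂ))) atTop
      (𝓝 (g : 𝓢'(R3, ℂ))) :=
    (Lp.toTemperedDistributionCLM ℂ (volume : Measure R3) 4).continuous.continuousAt.tendsto.comp hg
  refine tendsto_nhds_unique t1 (t2.congr fun n => ?_)
  rw [Lp.toTemperedDistribution_toLp_eq, Lp.toTemperedDistribution_toLp_eq,
    TemperedDistribution.fourier_toTemperedDistributionCLM_eq]

theorem isFourierTransform_fourierFourThirds (f : Lp ℂ (4 / 3) (volume : Measure R3)) :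
    IsFourierTransform f (fourierFourThirds f) := by
  obtain ⟨-, g, -, -, hg⟩ := exists_schwartz_tendsto_isFourierTransform f
  have h : ∃ g, IsFourierTransform f g := ⟨g, hg⟩
  rw [fourierFourThirds, dif_pos h]
  exact h.choose_spec

/-! ### Restriction by duality, and the Tomas–Stein bound. -/

/-- Extension estimate for functions supported in a set `S` all of whose
intersections `S ∩ (x - S)` have measure at most `κ ^ 4`. -/
theorem eLpNorm_fourier_le_of_support {S : Set R3} {κ : ℝ≥0∞}
    (hS : MeasurableSet S) (hκ : ∀ x, volume {y | y ∈ S ∧ x - y ∈ S} ≤ κ ^ 4)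
    {g : R3 → ℂ} (h1 : Integrable g) (hg : Measurable g) (hgS : ∀ y ∉ S, g y = 0) :
    eLpNorm (𝓕 g) 4 volume ≤ κ * eLpNorm g 2 volume := by
  refine (ENNReal.pow_le_pow_left_iff (n := 4) (by norm_num)).1 ?_
  have a := eLpNorm_pow_eq_lintegral (μ := volume) (𝓕 g) (n := 4) (by norm_num)
  have b := eLpNorm_pow_eq_lintegral (μ := volume) g (n := 2) (by norm_num)
  rw [Nat.cast_ofNat] at a b
  rw [a, mul_pow]
  refine (lintegral_fourier_pow_four_le_of_support hS hκ h1 hg hgS).trans (le_of_eq ?_)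
  rw [← b, ← pow_mul]

/-- Hölder's inequality for the pairing of `L^{4/3}` with `L⁴`. -/
theorem enorm_integral_smul_le {u v : R3 → ℂ} (hu : AEStronglyMeasurable u volume)
    (hv : AEStronglyMeasurable v volume) :
    ‖∫ x, u x • v x‖ₑ ≤ eLpNorm u (4 / 3) volume * eLpNorm v 4 volume := by
  have : ENNReal.HolderTriple (4 / 3) 4 1 := ⟨by
    rw [ENNReal.inv_div (by simp) (by simp), inv_one, ← one_div,
      ENNReal.div_add_div_same]
    norm_num
    exact ENNReal.div_self (by simp) (by simp)⟩
  have h := eLpNorm_smul_le_mul_eLpNorm (p := 4 / 3) (q := 4) (r := 1) hv hu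
  rw [eLpNorm_one_eq_lintegral_enorm] at h
  exact (enorm_integral_le_lintegral_enorm _).trans h

/-- The restriction estimate dual to `eLpNorm_fourier_le_of_support`, for Schwartz functions. -/
theorem eLpNorm_indicator_fourier_schwartz_le {S : Set R3} {κ : ℝ≥0∞}
    (hS : MeasurableSet S) (hκ : ∀ x, volume {y | y ∈ S ∧ x - y ∈ S} ≤ κ ^ 4) (s : 𝓢(R3, ℂ)) :
    eLpNorm (S.indicator ⇑(𝓕 s : 𝓢(R3, ℂ))) 2 volume ≤ κ * eLpNorm s (4 / 3) volume := by
  set h : R3 → ℂ := S.indicator ⇑(𝓕 s : 𝓢(R3, ℂ))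
  -- Pairing with the conjugate of the restricted transform produces its squared `L²` norm; moving
  -- the transform onto `k` brings in the extension estimate.
  set k : R3 → ℂ := fun ξ => starRingEnd ℂ (h ξ) with hk
  have hm : Measurable h := (𝓕 s).continuous.measurable.indicator hS
  have hkm : Measurable k := by fun_prop
  have hh2 : MemLp h 2 := (SchwartzMap.memLp (𝓕 s) 2 volume).indicator hS
  have hh1 : Integrable h := (SchwartzMap.integrable (𝓕 s)).indicator hS
  have hk1 : Integrable k := by
    refine hh1.mono hkm.aestronglyMeasurable (Eventually.of_forall fun ξ => by simp [hk])
  have hkn : eLpNorm k 2 volume = eLpNorm h 2 volume :=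
    eLpNorm_congr_norm_ae (Eventually.of_forall fun ξ => by simp [hk])
  have hkS : ∀ y ∉ S, k y = 0 := fun y hy => by simp [hk, h, hy]
  have hext := eLpNorm_fourier_le_of_support hS hκ hk1 hkm hkS
  rw [hkn] at hext
  have hflip : ∫ ξ, 𝓕 (s : R3 → ℂ) ξ • k ξ = ∫ x, s x • 𝓕 k x := by
    have := VectorFourier.integral_fourierIntegral_smul_eq_flip (μ := volume) (ν := volume)
      (L := innerₗ R3) Real.continuous_fourierChar continuous_inner s.integrable hk1
    rw [flip_innerₗ] at this
    exact this
  have hsq : (∫ ξ, 𝓕 (s : R3 → ℂ) ξ • k ξ) = ((∫ ξ, ‖h ξ‖ ^ 2 : ℝ) : ℂ) := by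
    rw [← integral_complex_ofReal]
    congr 1; ext ξ
    by_cases hξ : ξ ∈ S
    · simp [hk, h, hξ, SchwartzMap.fourier_coe, Complex.mul_conj, Complex.normSq_eq_norm_sq]
    · simp [hk, h, hξ]
  have hX : eLpNorm h 2 volume ^ 2 = ‖∫ ξ, 𝓕 (s : R3 → ℂ) ξ • k ξ‖ₑ := by
    have b := eLpNorm_pow_eq_lintegral (μ := volume) h (n := 2) (by norm_num)
    rw [Nat.cast_ofNat] at b
    rw [b, hsq, ← ofReal_norm, Complex.norm_real, Real.norm_of_nonneg (by positivity),
      ofReal_integral_eq_lintegral_ofReal (hh2.integrable_norm_pow (by norm_num))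
        (Eventually.of_forall fun ξ => by positivity)]
    congr 1; ext ξ
    rw [ENNReal.ofReal_pow (norm_nonneg _), ofReal_norm]
  have hkc : Continuous (𝓕 k) :=
    VectorFourier.fourierIntegral_continuous Real.continuous_fourierChar
      (by exact continuous_inner) hk1
  have hholder : ‖∫ x, s x • 𝓕 k x‖ₑ ≤ eLpNorm s (4 / 3) volume * eLpNorm (𝓕 k) 4 volume :=
    enorm_integral_smul_le s.continuous.aestronglyMeasurable hkc.aestronglyMeasurable
  rw [← hflip, ← hX] at hholder
  have hfinal : eLpNorm h 2 volume * eLpNorm h 2 volume ≤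
      κ * eLpNorm s (4 / 3) volume * eLpNorm h 2 volume := by
    calc _ = eLpNorm h 2 volume ^ 2 := (sq _).symm
      _ ≤ _ := hholder
      _ ≤ eLpNorm s (4 / 3) volume * (κ * eLpNorm h 2 volume) := by gcongr
      _ = _ := by ring
  -- One factor of the norm is cancelled, which requires it to be nonzero and finite.
  rcases eq_or_ne (eLpNorm h 2 volume) 0 with h0 | h0
  · rw [h0]; exact zero_le
  · exact (ENNReal.mul_le_mul_iff_left h0 hh2.2.ne).1 hfinal

/-- The restriction estimate for `L^{4/3}` functions. -/
theorem eLpNorm_indicator_fourierFourThirds_le {S : Set R3} {κ : ℝ≥0∞} (hκt : κ ≠ ⊤)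
    (hS : MeasurableSet S) (hSv : volume S ≠ ⊤)
    (hκ : ∀ x, volume {y | y ∈ S ∧ x - y ∈ S} ≤ κ ^ 4)
    (f : Lp ℂ (4 / 3) (volume : Measure R3)) :
    eLpNorm (S.indicator (fourierFourThirds f)) 2 volume ≤ κ * eLpNorm f (4 / 3) volume := by
  obtain ⟨s, g, hs, hg, hfg⟩ := exists_schwartz_tendsto_isFourierTransform f
  rw [(isFourierTransform_fourierFourThirds f).unique hfg]
  have hfin : IsFiniteMeasure (volume.restrict S) := ⟨by simpa using hSv.lt_top⟩
  -- On the finite-measure set `S`, `L⁴` embeds in `L²`. The size of `c` is irrelevant: it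
  -- multiplies an approximation error that tends to `0`.
  obtain ⟨c, hct, hc⟩ : ∃ c : ℝ≥0∞, c ≠ ⊤ ∧ ∀ u : R3 → ℂ, AEStronglyMeasurable u volume →
      eLpNorm (S.indicator u) 2 volume ≤ eLpNorm u 4 volume * c := by
    refine ⟨volume S ^ (1 / (2 : ℝ≥0∞).toReal - 1 / (4 : ℝ≥0∞).toReal),
      ENNReal.rpow_ne_top_of_nonneg (by norm_num) hSv, fun u hu => ?_⟩
    rw [eLpNorm_indicator_eq_eLpNorm_restrict hS]
    have := eLpNorm_le_eLpNorm_mul_rpow_measure_univ (μ := volume.restrict S)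
      (p := 2) (q := 4) (by norm_num) hu.restrict
    rw [Measure.restrict_apply_univ] at this
    refine this.trans ?_
    gcongr
    exact Measure.restrict_le_self
  have hbound : ∀ n, eLpNorm (S.indicator g) 2 volume ≤
      c * ‖g - (𝓕 (s n)).toLp 4‖ₑ + κ * ‖(s n).toLp (4 / 3) (volume : Measure R3)‖ₑ := fun n => by
    have hgn : AEStronglyMeasurable ⇑(𝓕 (s n) : 𝓢(R3, ℂ)) volume :=
      (𝓕 (s n)).continuous.aestronglyMeasurable
    have e : S.indicator g = S.indicator (⇑g - ⇑(𝓕 (s n) : 𝓢(R3, ℂ))) + S.indicator ⇑(𝓕 (s n) : 𝓢(R3, ℂ)) := by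
      rw [← Set.indicator_add']; simp
    rw [e]
    refine (eLpNorm_add_le (((Lp.aestronglyMeasurable g).sub hgn).indicator hS)
      (hgn.indicator hS) (by norm_num)).trans ?_
    gcongr
    · refine (hc _ ((Lp.aestronglyMeasurable g).sub hgn)).trans (le_of_eq ?_)
      rw [mul_comm, Lp.enorm_def]
      congr 1
      refine eLpNorm_congr_ae ?_
      filter_upwards [Lp.coeFn_sub g ((𝓕 (s n)).toLp 4), SchwartzMap.coeFn_toLp (𝓕 (s n)) 4 volume]
        with x h1 h2
      rw [h1, Pi.sub_apply, Pi.sub_apply, h2]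
    · rw [Lp.enorm_def, eLpNorm_congr_ae (SchwartzMap.coeFn_toLp _ _ _)]
      exact eLpNorm_indicator_fourier_schwartz_le hS hκ (s n)
  have hlim : Tendsto (fun n => c * ‖g - (𝓕 (s n)).toLp 4‖ₑ +
      κ * ‖(s n).toLp (4 / 3) (volume : Measure R3)‖ₑ) atTop (𝓝 (c * 0 + κ * ‖f‖ₑ)) := by
    refine (ENNReal.Tendsto.const_mul ?_ (Or.inr hct)).add
      (ENNReal.Tendsto.const_mul hs.enorm (Or.inr hκt))
    have := (tendsto_const_nhds (x := g)).sub hg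
    simpa using this.enorm
  have := ge_of_tendsto' hlim hbound
  rwa [mul_zero, zero_add, Lp.enorm_def] at this

theorem eLpNorm_fourierInv_eq {g : R3 → ℂ} (hg : Integrable g) (p : ℝ≥0∞) :
    eLpNorm (𝓕⁻ g) p volume = eLpNorm (𝓕 g) p volume := by
  have hc : Continuous (𝓕 g) :=
    VectorFourier.fourierIntegral_continuous Real.continuous_fourierChar
      (by exact continuous_inner) hg
  have : 𝓕⁻ g = 𝓕 g ∘ Neg.neg := funext fun x => Real.fourierInv_eq_fourier_neg g x
  rw [this]
  exact eLpNorm_comp_measurePreserving hc.aestronglyMeasurable (Measure.measurePreserving_neg _)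

theorem continuous_fourierInv {g : R3 → ℂ} (hg : Integrable g) : Continuous (𝓕⁻ g) := by
  have hc : Continuous (𝓕 g) :=
    VectorFourier.fourierIntegral_continuous Real.continuous_fourierChar
      (by exact continuous_inner) hg
  have : 𝓕⁻ g = 𝓕 g ∘ Neg.neg := funext fun x => Real.fourierInv_eq_fourier_neg g x
  rw [this]
  exact hc.comp continuous_neg

/-- Integrability of a bounded multiplier times an `L⁴` function, on a set of finite measure. -/
theorem integrable_indicator_mul {S : Set R3} (hS : MeasurableSet S) (hSv : volume S ≠ ⊤)
    {m : R3 → ℂ} (hm : Measurable m) {B : ℝ} (hB : ∀ ξ, ‖m ξ‖ ≤ B)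
    (g : Lp ℂ 4 (volume : Measure R3)) : Integrable (S.indicator fun ξ => m ξ * g ξ) := by
  have hfin : IsFiniteMeasure (volume.restrict S) := ⟨by simpa using hSv.lt_top⟩
  rw [integrable_indicator_iff hS]
  have hg : Integrable g (volume.restrict S) :=
    ((Lp.memLp g).restrict S).integrable (by norm_num)
  exact hg.bdd_mul hm.aestronglyMeasurable (Eventually.of_forall hB)

/-- The Tomas–Stein bound for a bounded multiplier supported in `S`. -/
theorem eLpNorm_fourierInv_indicator_mul_le {S : Set R3} {κ : ℝ≥0∞} (hκt : κ ≠ ⊤)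
    (hS : MeasurableSet S) (hSv : volume S ≠ ⊤)
    (hκ : ∀ x, volume {y | y ∈ S ∧ x - y ∈ S} ≤ κ ^ 4)
    {m : R3 → ℂ} (hm : Measurable m) {B : ℝ} (hB : ∀ ξ, ‖m ξ‖ ≤ B)
    (f : Lp ℂ (4 / 3) (volume : Measure R3)) :
    eLpNorm (𝓕⁻ (S.indicator fun ξ => m ξ * fourierFourThirds f ξ)) 4 volume ≤
      κ ^ 2 * ENNReal.ofReal B * eLpNorm f (4 / 3) volume := by
  set g := fourierFourThirds f
  have hi := integrable_indicator_mul hS hSv hm hB g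
  have hgm : Measurable g := (Lp.stronglyMeasurable g).measurable
  rw [eLpNorm_fourierInv_eq hi]
  refine (eLpNorm_fourier_le_of_support hS hκ hi ((hm.mul hgm).indicator hS)
    (fun y hy => by simp [hy])).trans ?_
  have hle : eLpNorm (S.indicator fun ξ => m ξ * g ξ) 2 volume ≤
      ENNReal.ofReal B * eLpNorm (S.indicator g) 2 volume := by
    refine eLpNorm_le_mul_eLpNorm_of_ae_le_mul (Eventually.of_forall fun ξ => ?_) 2
    by_cases hξ : ξ ∈ S
    · simp only [Set.indicator_of_mem hξ, norm_mul]
      gcongr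
      exact hB ξ
    · simp [hξ]
  calc _ ≤ κ * (ENNReal.ofReal B * (κ * eLpNorm f (4 / 3) volume)) := by
        gcongr
        refine hle.trans ?_
        gcongr
        exact eLpNorm_indicator_fourierFourThirds_le hκt hS hSv hκ f
    _ = _ := by ring

/-! ### Shell operators and their sum. -/

/-- On the support of `ψ j` the distance to the sphere is already at least `2^{-j-1}`, so `ε` can
only enlarge the denominator and the bound is free of it. -/
theorem abs_shellSymbol_le {ψ : ℕ → ℝ → ℝ} (hψ : IsDyadicPartition ψ) {M : ℝ}
    (hM : ∀ j r, |ψ j r| ≤ M) {ε : ℝ} (hε : 0 < ε) (ΔE : ℝ) (j : ℕ) (r : ℝ) :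
    |shellSymbol ψ ΔE ε j r| ≤ M * 2 ^ (j + 1) := by
  have hM0 : 0 ≤ M := (abs_nonneg _).trans (hM 0 0)
  by_cases h : |r - ΔE| ∈ tsupport (ψ j)
  · have h1 := (hψ.tsupport_subset j h).1
    have h2 : ((2 : ℝ) ^ (j + 1))⁻¹ ≤ |r - ΔE| + ε := by
      have e : ((2 : ℝ) ^ (j + 1))⁻¹ = (2 : ℝ) ^ (-(j : ℤ) - 1) := by
        rw [← zpow_natCast, ← zpow_neg]; congr 1; push_cast; ring
      rw [e]; linarith
    rw [shellSymbol, abs_div, abs_of_pos (by positivity : 0 < |r - ΔE| + ε), div_eq_mul_inv]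
    gcongr
    · exact hM _ _
    · exact inv_le_of_inv_le₀ (by positivity) h2
  · rw [shellSymbol, image_eq_zero_of_notMem_tsupport h]
    simp only [zero_div, abs_zero]
    positivity

theorem shellSymbol_eq_zero {ψ : ℕ → ℝ → ℝ} (hψ : IsDyadicPartition ψ) {ΔE ε : ℝ} {j : ℕ} {r : ℝ}
    (h : 2 * ((2 : ℝ) ^ j)⁻¹ < |r - ΔE|) : shellSymbol ψ ΔE ε j r = 0 := by
  have : |r - ΔE| ∉ tsupport (ψ j) := fun hmem => by
    have h1 := (hψ.tsupport_subset j hmem).2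
    have e : (2 : ℝ) ^ (-(j : ℤ) + 1) = 2 * ((2 : ℝ) ^ j)⁻¹ := by
      rw [zpow_add₀ two_ne_zero, zpow_neg, zpow_natCast, zpow_one, mul_comm]
    linarith
  rw [shellSymbol, image_eq_zero_of_notMem_tsupport this, zero_div]

theorem measurable_shellSymbol {ψ : ℕ → ℝ → ℝ} (hψ : IsDyadicPartition ψ) (ΔE ε : ℝ) (j : ℕ) :
    Measurable fun ξ : R3 => (shellSymbol ψ ΔE ε j (2 * Real.pi * ‖ξ‖) : ℂ) := by
  have : Measurable (ψ j) := (hψ.contDiff j).continuous.measurable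
  unfold shellSymbol
  fun_prop

/-- Each shell operator maps `L^{4/3}` to `L⁴` with a bound independent of `j` and `ε`. -/
theorem shellOp_bound {ΔE : ℝ} (hΔE : 0 < ΔE) (M : ℝ) :
    ∃ C : ℝ, 0 ≤ C ∧ ∀ ψ : ℕ → ℝ → ℝ, IsDyadicPartition ψ → (∀ j r, |ψ j r| ≤ M) →
      ∀ ε : ℝ, 0 < ε → ∀ (j : ℕ) (f : Lp ℂ (4 / 3) (volume : Measure R3)),
        Continuous (shellOp ψ ΔE ε j f) ∧
        eLpNorm (shellOp ψ ΔE ε j f) 4 volume ≤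
          ENNReal.ofReal C * eLpNorm f (4 / 3) volume := by
  have hpi := Real.pi_pos
  set r := ΔE / (2 * Real.pi) with hr
  have hr0 : 0 < r := by positivity
  set A := (36 + 32 * r) * Real.pi with hA
  have hA0 : 0 ≤ A := by positivity
  -- The factor `8` counts the octants.
  refine ⟨8 * (√A * |M| * 2), by positivity, fun ψ hψ hM ε hε j f => ?_⟩
  have hM0 : 0 ≤ M := (abs_nonneg _).trans (hM 0 0)
  -- The symbol vanishes when `|2π‖ξ‖ - ΔE| > 2 · 2^{-j}`; dividing by `2π` gives this thickness
  -- around radius `r`.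
  set d := ((2 : ℝ) ^ j)⁻¹ / Real.pi with hd
  have hd0 : 0 < d := by positivity
  have hd1 : d ≤ 1 := by
    rw [hd, div_le_one hpi]
    exact (inv_le_one_of_one_le₀ (one_le_pow₀ one_le_two)).trans (by linarith [Real.pi_gt_three])
  set κ : ℝ≥0∞ := ENNReal.ofReal √(√A * d) with hκ
  have hκ2 : κ ^ 2 = ENNReal.ofReal (√A * d) := by
    rw [hκ, ← ENNReal.ofReal_pow (by positivity), Real.sq_sqrt (by positivity)]
  have hκ4 : κ ^ 4 = ENNReal.ofReal (A * d ^ 2) := by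
    rw [show 4 = 2 * 2 from rfl, pow_mul, hκ2, ← ENNReal.ofReal_pow (by positivity), mul_pow,
      Real.sq_sqrt hA0]
  set m : R3 → ℂ := fun ξ => (shellSymbol ψ ΔE ε j (2 * Real.pi * ‖ξ‖) : ℂ) with hm
  have hmm : Measurable m := measurable_shellSymbol hψ ΔE ε j
  have hmB : ∀ ξ, ‖m ξ‖ ≤ M * 2 ^ (j + 1) := fun ξ => by
    rw [hm, Complex.norm_real, Real.norm_eq_abs]
    exact abs_shellSymbol_le hψ hM hε ΔE j _
  set g := fourierFourThirds f with hg
  set G : (Fin 3 → Bool) → R3 → ℂ := fun b =>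
    (shellPiece r d b).indicator fun ξ => m ξ * g ξ with hG
  have hvol : ∀ b, volume (shellPiece r d b) ≠ ⊤ := fun b =>
    ((measure_mono (shellPiece_subset_closedBall r d b)).trans_lt
      measure_closedBall_lt_top).ne
  have hGi : ∀ b, Integrable (G b) := fun b =>
    integrable_indicator_mul (measurableSet_shellPiece r d b) (hvol b) hmm hmB g
  have hsum : (fun ξ => m ξ * g ξ) = fun ξ => ∑ b, G b ξ := by
    ext ξ
    by_cases hξ : |‖ξ‖ - r| ≤ d
    · rw [Finset.sum_eq_single (octant ξ)]
      · have hmem : ξ ∈ shellPiece r d (octant ξ) := ⟨hξ, rfl⟩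
        simp only [hG, Set.indicator_of_mem hmem]
      · exact fun b _ hb => Set.indicator_of_notMem (fun h => hb h.2.symm) _
      · simp
    · have hz : m ξ = 0 := by
        rw [hm, Complex.ofReal_eq_zero]
        refine shellSymbol_eq_zero hψ ?_
        have e : 2 * Real.pi * ‖ξ‖ - ΔE = 2 * Real.pi * (‖ξ‖ - r) := by
          rw [hr]; field_simp
        rw [e, abs_mul, abs_of_pos (by positivity : 0 < 2 * Real.pi)]
        calc 2 * ((2 : ℝ) ^ j)⁻¹ = 2 * Real.pi * d := by rw [hd]; field_simp
          _ < _ := by gcongr; exact not_le.1 hξ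
      rw [hz, zero_mul, Finset.sum_eq_zero fun b _ =>
        Set.indicator_of_notMem (fun h => hξ h.1) _]
  have hop : shellOp ψ ΔE ε j f = ∑ b, 𝓕⁻ (G b) := by
    change 𝓕⁻ (fun ξ => m ξ * g ξ) = _
    rw [hsum]
    ext x
    rw [Finset.sum_apply]
    simp only [Real.fourierInv_eq, Finset.smul_sum]
    refine integral_finsetSum _ fun b _ => ?_
    have := (Real.fourierIntegral_convergent_iff (μ := volume) (f := G b) (-x)).2 (hGi b)
    simpa using this
  rw [hop]
  refine ⟨by
    simpa only [← Finset.sum_apply] using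
      continuous_finsetSum Finset.univ fun b _ => continuous_fourierInv (hGi b), ?_⟩
  have hpiece : ∀ b, eLpNorm (𝓕⁻ (G b)) 4 volume ≤
      ENNReal.ofReal (√A * |M| * 2) * eLpNorm f (4 / 3) volume := fun b => by
    refine (eLpNorm_fourierInv_indicator_mul_le (κ := κ) ENNReal.ofReal_ne_top
      (measurableSet_shellPiece r d b) (hvol b)
      (fun x => ?_) hmm hmB f).trans ?_
    · rw [hκ4]
      exact volume_shellPiece_inter_le hr0 hd0 hd1 b x
    · gcongr
      rw [hκ2, ← ENNReal.ofReal_mul (by positivity)]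
      refine ENNReal.ofReal_le_ofReal ?_
      -- The decisive cancellation: the thickness `2^{-j}` in `κ²` absorbs the size `2^{j+1}` of the
      -- symbol.
      have e : √A * d * (M * 2 ^ (j + 1)) = √A * M * 2 / Real.pi := by
        rw [hd, pow_succ]; field_simp
      rw [e, abs_of_nonneg hM0]
      exact div_le_self (by positivity) (by linarith [Real.pi_gt_three])
  calc _ ≤ ∑ b : Fin 3 → Bool, eLpNorm (𝓕⁻ (G b)) 4 volume :=
        eLpNorm_sum_le (fun b _ => (continuous_fourierInv (hGi b)).aestronglyMeasurable)
          (by norm_num)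
    _ ≤ ∑ b : Fin 3 → Bool, ENNReal.ofReal (√A * |M| * 2) * eLpNorm f (4 / 3) volume :=
        Finset.sum_le_sum fun b _ => hpiece b
    _ = _ := by
      rw [Finset.sum_const, ENNReal.ofReal_mul (by norm_num : (0 : ℝ) ≤ 8)]
      simp [mul_assoc]

/-- The extra `1` is absorbed by `log (1/ε) ≥ log (1/ε₀) > 0`; this is where `ε` must stay away from
`1`. -/
theorem lastShell_add_one_le {ε ε₀ : ℝ} (hε : 0 < ε) (hεε₀ : ε ≤ ε₀) (hε₀ : ε₀ < 1) :
    (lastShell ε + 1 : ℝ) ≤ (1 / Real.log 2 + 1 / Real.log (1 / ε₀)) * Real.log (1 / ε) := by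
  have hε₀0 : 0 < ε₀ := hε.trans_le hεε₀
  have h0 : 0 < Real.log (1 / ε₀) := Real.log_pos (by rw [lt_div_iff₀ hε₀0]; linarith)
  have h1 : Real.log (1 / ε₀) ≤ Real.log (1 / ε) :=
    Real.log_le_log (by positivity) (one_div_le_one_div_of_le hε hεε₀)
  have h2 : (lastShell ε : ℝ) ≤ Real.log (1 / ε) / Real.log 2 :=
    Nat.floor_le (div_nonneg (by linarith) (Real.log_pos one_lt_two).le)
  have h3 : 1 ≤ Real.log (1 / ε) / Real.log (1 / ε₀) := by rwa [le_div_iff₀ h0, one_mul]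
  calc _ ≤ _ := add_le_add h2 h3
    _ = _ := by ring

/-- The first conjunct certifies that the default value `0` in `fourierFourThirds` is never taken.
-/
theorem mainTheorem8 (ΔE : ℝ) (hΔE : 0 < ΔE) (M : ℝ) (ε₀ : ℝ) (hε₀ : ε₀ < 1) :
    ∃ C : ℝ, 0 < C ∧
      ∀ ψ : ℕ → ℝ → ℝ, IsDyadicPartition ψ → (∀ j r, |ψ j r| ≤ M) →
      ∀ ε : ℝ, 0 < ε → ε ≤ ε₀ →
      ∀ f : Lp ℂ (4 / 3) (volume : Measure R3),
        IsFourierTransform f (fourierFourThirds f) ∧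
        MemLp (regularizedMultiplier ψ ΔE ε f) 4 volume ∧
        eLpNorm (regularizedMultiplier ψ ΔE ε f) 4 volume ≤
          ENNReal.ofReal (C * Real.log (1 / ε)) * eLpNorm f (4 / 3) volume := by
  obtain ⟨C, hC, hshell⟩ := shellOp_bound hΔE M
  set L := 1 / Real.log 2 + 1 / Real.log (1 / ε₀) with hL
  -- The maximum with `1` keeps the constant positive even if `C = 0`, or if `ε₀ ≤ 0` makes `L`
  -- meaningless.
  refine ⟨max (L * C) 1, by positivity, fun ψ hψ hM ε hε hεε₀ f => ?_⟩
  have hlog : 0 ≤ Real.log (1 / ε) :=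
    Real.log_nonneg (by rw [le_div_iff₀ hε]; linarith)
  have hop : regularizedMultiplier ψ ΔE ε f =
      ∑ j ∈ Finset.range (lastShell ε + 1), shellOp ψ ΔE ε j f := by
    ext x; rw [Finset.sum_apply]; rfl
  have hbound : eLpNorm (regularizedMultiplier ψ ΔE ε f) 4 volume ≤
      ENNReal.ofReal (max (L * C) 1 * Real.log (1 / ε)) * eLpNorm f (4 / 3) volume := by
    rw [hop]
    calc _ ≤ ∑ j ∈ Finset.range (lastShell ε + 1), eLpNorm (shellOp ψ ΔE ε j f) 4 volume :=
          eLpNorm_sum_le (fun j _ => (hshell ψ hψ hM ε hε j f).1.aestronglyMeasurable)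
            (by norm_num)
      _ ≤ ∑ j ∈ Finset.range (lastShell ε + 1),
            ENNReal.ofReal C * eLpNorm f (4 / 3) volume :=
          Finset.sum_le_sum fun j _ => (hshell ψ hψ hM ε hε j f).2
      _ = ENNReal.ofReal ((lastShell ε + 1 : ℝ) * C) * eLpNorm f (4 / 3) volume := by
          rw [Finset.sum_const, Finset.card_range, nsmul_eq_mul, ← mul_assoc,
            ENNReal.ofReal_mul (by positivity), ← Nat.cast_add_one, ENNReal.ofReal_natCast]
      _ ≤ _ := by
          refine mul_le_mul_left (ENNReal.ofReal_le_ofReal ?_) _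
          calc (lastShell ε + 1 : ℝ) * C ≤ L * Real.log (1 / ε) * C := by
                gcongr
                exact lastShell_add_one_le hε hεε₀ hε₀
            _ = L * C * Real.log (1 / ε) := by ring
            _ ≤ _ := by gcongr; exact le_max_left _ _
  refine ⟨isFourierTransform_fourierFourThirds f, ⟨?_, hbound.trans_lt ?_⟩, hbound⟩
  · exact (continuous_finsetSum (Finset.range (lastShell ε + 1)) fun j _ =>
      (hshell ψ hψ hM ε hε j f).1).aestronglyMeasurable
  · exact ENNReal.mul_lt_top ENNReal.ofReal_lt_top (Lp.eLpNorm_lt_top f)
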